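/- **Setting.** Let $\mathcal A=\mathbb C^2$ be one qubit and $\mathcal W=(\mathbb C^2)^{\otimes m}$ a register of $m\ge 0$ qubits. For $p\in[0,1]$ and unit vectors $\phi_0,\phi_1\in\mathcal W$, call a unitary $O_{\mathrm{ref}}$ on $\mathcal A\otimes\mathcal W$ a *reflecting oracle* for $(p,\phi_0,\phi_1)$ if $$O_{\mathrm{ref}}\colon\ \begin{cases}\sqrt{1-p}\,|0\rangle|\phi_0\rangle+\sqrt p\,|1\rangle|\phi_1\rangle\ \mapsto\ \sqrt{1-p}\,|0\rangle|\phi_0\rangle+\sqrt p\,|1\rangle|\phi_1\rangle,\\ \sqrt p\,|0\rangle|\phi_0\rangle-\sqrt{1-p}\,|1\rangle|\phi_1\rangle\ \mapsto\ -\sqrt p\,|0\rangle|\phi_0\rangle+\sqrt{1-p}\,|1\rangle|\phi_1\rangle;\end{cases}$$ it may be arbitrary on the orthogonal complement of $\mathrm{span}\{|0\rangle|\phi_0\rangle,|1\rangle|\phi_1\rangle\}$. A *quantum query algorithm* on $\mathcal A\otimes\mathcal W$ is a finite sequence of steps, each of which is either a query (an application of $O_{\mathrm{ref}}$ to $\mathcal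 A\otimes\mathcal W$) or an arbitrary unitary gate on one qubit or on two distinct qubits of $\mathcal A\otimes\mathcal W$; the gates do not depend on the oracle. Its action $A(O_{\mathrm{ref}})$ is the product of its steps. **Theorem 1.4 (QSP-based error reduction).** There is an absolute constant $C>0$ such that for all real $\varepsilon,\delta>0$ and all $m\ge 0$ there is a quantum query algorithm $A$ on the $m+1$ qubits of $\mathcal A\otimes\mathcal W$ (so it uses no qubits other than those on which the oracle acts) with the following properties. 1. For all $p\in[0,1]$, all unit vectors $\phi_0,\phi_1\in\mathcal W$, every reflecting oracle $O_{\mathrm{ref}}$ for $(p,\phi_0,\phi_1)$, and every unit vector $\phi\in\mathrm{span}\{|0\rangle|\phi_0\rangle,|1\rangle|\phi_1\rangle\}$, $$\begin{cases}\|A(O_{\mathrm{ref}})\phi-\phi\|\le\varepsilon, & \text{if } p\le\tfrac12-\delta,\\ \|A(O_{\mathrm{ref}})\phi-(-\phi)\|\le\varepsilon, & \text{if } p\ge\tfrac12+\delta.\end{cases}$$ 2. $A$ makes $\ell\le C\cdot\frac1\delta\max\{1,\log\frac1\varepsilon\}$ queries, that is, $\ell=O\big(\frac1\delta\log\frac1\varepsilon\big)$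 as soon as $\varepsilon$ is bounded away from $1$, e.g. $\varepsilon\le\frac12$. 3. $A$ uses at most $C\ell$ one- and two-qubit gates besides the queries. -/

import Mathlib

noncomputable section

namespace QErr

/-- The Hilbert space of `n` qubits: complex amplitudes indexed by bit strings of length `n`,
with the Euclidean (`ℓ²`) norm. -/
abbrev Qubits (n : ℕ) : Type := EuclideanSpace ℂ (Fin n → Fin 2)

/-- The state `|a⟩_A ⊗ |w⟩_W` of the register `A ⊗ W`, where `A` is one qubit (qubit number `0`)
and `W` consists of `m` qubits (qubits number `1, …, m`). -/
def ketA {m : ℕ} (a : Fin 2) (w : Qubits m) : Qubits (m + 1) :=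
  WithLp.toLp 2 fun b => if b 0 = a then w (Fin.tail b) else 0

/-- One step of a quantum query algorithm on `n` qubits: an arbitrary unitary on one qubit,
an arbitrary unitary on two distinct qubits, or a query to the input oracle. -/
inductive Step (n : ℕ) : Type
  | gate1 (i : Fin n) (U : Matrix.unitaryGroup (Fin 2) ℂ) : Step n
  | gate2 (i j : Fin n) (hij : i ≠ j) (U : Matrix.unitaryGroup (Fin 2 × Fin 2) ℂ) : Step n
  | query : Step n

namespace Step

/-- The action of a step on a state, when the input oracle is the unitary `O`. A gate acts on the
qubits it names and as the identity on the others; a query applies `O` to the whole register. -/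
def act {n : ℕ} (O : Qubits n ≃ₗᵢ[ℂ] Qubits n) : Step n → Qubits n → Qubits n
  | gate1 i U, ψ => WithLp.toLp 2 fun b =>
      ∑ c : Fin 2, (U : Matrix (Fin 2) (Fin 2) ℂ) (b i) c * ψ (Function.update b i c)
  | gate2 i j _ U, ψ => WithLp.toLp 2 fun b =>
      ∑ c : Fin 2 × Fin 2, (U : Matrix (Fin 2 × Fin 2) (Fin 2 × Fin 2) ℂ) (b i, b j) c *
        ψ (Function.update (Function.update b i c.1) j c.2)
  | query, ψ => O ψ

/-- Whether a step is a query. -/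
def isQuery {n : ℕ} : Step n → Bool
  | query => true
  | _ => false

end Step

/-- A quantum query algorithm on `n` qubits, in the circuit model: a finite sequence of gates and
queries, the head of the list being executed first. -/
abbrev QueryAlgorithm (n : ℕ) : Type := List (Step n)

namespace QueryAlgorithm

/-- The final state of the algorithm with input oracle `O`, started in the state `ψ`. -/
def run {n : ℕ} (O : Qubits n ≃ₗᵢ[ℂ] Qubits n) (A : QueryAlgorithm n) (ψ : Qubits n) : Qubits n :=
  A.foldl (fun χ s => s.act O χ) ψ

/-- The number of queries to the input oracle. -/
def queries {n : ℕ} (A : QueryAlgorithm n) : ℕ := A.countP fun s => s.isQuery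

/-- The number of 1- and 2-qubit gates. -/
def gates {n : ℕ} (A : QueryAlgorithm n) : ℕ := A.countP fun s => !s.isQuery

end QueryAlgorithm

/-- The unitary `O` on `A ⊗ W` is a reflecting oracle for the data `p, φ₀, φ₁`: on the span of
`|0⟩|φ₀⟩` and `|1⟩|φ₁⟩` it is the reflection about `√(1-p) |0⟩|φ₀⟩ + √p |1⟩|φ₁⟩`.
On the orthogonal complement of this span it is unconstrained. -/
def IsReflectingOracle {m : ℕ} (p : ℝ) (φ₀ φ₁ : Qubits m)
    (O : Qubits (m + 1) ≃ₗᵢ[ℂ] Qubits (m + 1)) : Prop :=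
  O (((√(1 - p) : ℝ) : ℂ) • ketA 0 φ₀ + ((√p : ℝ) : ℂ) • ketA 1 φ₁) =
      ((√(1 - p) : ℝ) : ℂ) • ketA 0 φ₀ + ((√p : ℝ) : ℂ) • ketA 1 φ₁ ∧
  O (((√p : ℝ) : ℂ) • ketA 0 φ₀ - ((√(1 - p) : ℝ) : ℂ) • ketA 1 φ₁) =
      -(((√p : ℝ) : ℂ) • ketA 0 φ₀) + ((√(1 - p) : ℝ) : ℂ) • ketA 1 φ₁

end QErr

end

/-! On the plane spanned by |0⟩|φ₀⟩ and |1⟩|φ₁⟩ the oracle is the reflection with entries c = 1 - 2p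
and s = 2√(p(1-p)), and diagonal phase gates on the qubit A preserve the plane. Alternating such
phases with n queries is quantum signal processing: every SU(2) matrix with first column (P(c), s
Q(c)) is realized, provided P and Q have degrees at most n and n - 1, the matching parities, and
|P|² + (1 - x²)|Q|² = 1 (`exists_circuit`). The proof strips off one query at a time, choosing the
phase that cancels leading coefficients.

Such a matrix moves every unit vector φ of the plane to squared distance 2(1 - σ Re P(c)) from σφ, σ
= ±1, so only R = Re P matters. Any real R of definite parity with |R| < 1 on [-1, 1] can occur,
because 1 - R² = A² + (1 - x²)B² is solvable by factoring into real linear and quadratic factors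
(`isParityNorm_of_pos`).

It remains to find an odd R of degree O((1/δ) max{1, log(1/ε)}) close to the sign function for 2δ ≤
|x| ≤ 1. The normalized antiderivative of (T_k(x)/x)^(2r) serves, with T_k the Chebyshev polynomial,
k of order 1/δ and r of order max{1, log(1/ε)} (`exists_sign_approximation`). -/

noncomputable section

open Polynomial

/-! ### Polynomials of definite parity -/

namespace Polynomial

variable {R : Type*} [CommRing R]

/-- All monomials of `P` have degree at most `n` and of the same parity as `n`. -/
def HasParity (n : ℤ) (P : R[X]) : Prop :=
  ∀ k : ℕ, P.coeff k ≠ 0 → ∃ j : ℕ, (k : ℤ) + 2 * j = n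

namespace HasParity

variable {n m : ℤ} {P Q : R[X]}

theorem cast (h : HasParity n P) (e : n = m) : HasParity m P := e ▸ h

theorem zero : HasParity n (0 : R[X]) := fun k h => absurd (coeff_zero k) h

theorem add (hP : HasParity n P) (hQ : HasParity n Q) : HasParity n (P + Q) := by
  intro k hk
  by_cases h : P.coeff k = 0
  · exact hQ k (by simpa [h] using hk)
  · exact hP k h

theorem neg (hP : HasParity n P) : HasParity n (-P) := fun k hk => hP k (by simpa using hk)

theorem sub (hP : HasParity n P) (hQ : HasParity n Q) : HasParity n (P - Q) := by
  rw [sub_eq_add_neg]; exact hP.add hQ.neg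

theorem C (a : R) : HasParity 0 (Polynomial.C a) := by
  intro k hk
  rw [coeff_C] at hk
  exact ⟨0, by simpa using of_not_not fun h => hk (if_neg h)⟩

theorem X : HasParity 1 (Polynomial.X : R[X]) := by
  intro k hk
  rw [coeff_X] at hk
  exact ⟨0, by have := of_not_not fun h => hk (if_neg h); omega⟩

theorem mul (hP : HasParity n P) (hQ : HasParity m Q) : HasParity (n + m) (P * Q) := by
  intro k hk
  rw [coeff_mul] at hk
  obtain ⟨⟨a, b⟩, hab, hne⟩ := Finset.exists_ne_zero_of_sum_ne_zero hk
  obtain ⟨i, hi⟩ := hP a (left_ne_zero_of_mul hne)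
  obtain ⟨j, hj⟩ := hQ b (right_ne_zero_of_mul hne)
  have hab' : a + b = k := Finset.HasAntidiagonal.mem_antidiagonal.mp hab
  exact ⟨i + j, by push_cast; omega⟩

theorem C_mul (a : R) (hP : HasParity n P) : HasParity n (Polynomial.C a * P) :=
  ((C a).mul hP).cast (zero_add n)

theorem pow (hP : HasParity n P) (r : ℕ) : HasParity (r * n) (P ^ r) := by
  induction r with
  | zero => simpa using C (1 : R)
  | succ r ih => rw [pow_succ]; exact (ih.mul hP).cast (by push_cast; ring)

theorem add_two (hP : HasParity n P) : HasParity (n + 2) P := by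
  intro k hk
  obtain ⟨j, hj⟩ := hP k hk
  exact ⟨j + 1, by push_cast; omega⟩

theorem add_two_mul (hP : HasParity n P) (r : ℕ) : HasParity (n + 2 * r) P := by
  intro k hk
  obtain ⟨j, hj⟩ := hP k hk
  exact ⟨j + r, by push_cast; omega⟩

theorem one_sub_X_sq : HasParity 2 (1 - Polynomial.X ^ 2 : R[X]) :=
  ((C (1 : R)).add_two).sub ((X.pow 2).cast (by norm_num))

theorem sub_two (hP : HasParity n P) (h : P.coeff n.toNat = 0) : HasParity (n - 2) P := by
  intro k hk
  obtain ⟨j, hj⟩ := hP k hk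
  rcases j with _ | j
  · exact absurd h (by rwa [show n.toNat = k by omega])
  · exact ⟨j, by push_cast at hj; omega⟩

theorem map {S : Type*} [CommRing S] (f : R →+* S) (hP : HasParity n P) :
    HasParity n (P.map f) :=
  fun k hk => hP k fun h => hk (by rw [coeff_map, h, map_zero])

theorem natDegree_le (hP : HasParity n P) : P.natDegree ≤ n.toNat := by
  rw [natDegree_le_iff_coeff_eq_zero]
  intro k hk
  by_contra h
  obtain ⟨j, hj⟩ := hP k h
  omega

theorem eval_neg {n : ℕ} (hP : HasParity n P) (x : R) :
    P.eval (-x) = (-1) ^ n * P.eval x := by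
  rw [eval_eq_sum, eval_eq_sum, Polynomial.sum, Polynomial.sum, Finset.mul_sum]
  refine Finset.sum_congr rfl fun k hk => ?_
  obtain ⟨j, hj⟩ := hP k (mem_support_iff.mp hk)
  have : n = k + 2 * j := by omega
  rw [neg_pow x k, this, pow_add, pow_mul]
  ring

theorem exists_expand_two {n : ℕ} (hP : HasParity (2 * n) P) :
    ∃ p : R[X], p.natDegree ≤ n ∧ p.comp (Polynomial.X ^ 2) = P := by
  refine ⟨contract 2 P, ?_, ?_⟩
  · rw [natDegree_le_iff_coeff_eq_zero]
    intro k hk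
    rw [coeff_contract two_ne_zero]
    by_contra h
    obtain ⟨j, hj⟩ := hP _ h
    push_cast at hj
    omega
  · rw [← expand_eq_comp_X_pow]
    ext k
    rw [coeff_expand two_pos]
    split_ifs with h
    · rw [coeff_contract two_ne_zero, Nat.div_mul_cancel h]
    · by_contra h'
      obtain ⟨j, hj⟩ := hP k (Ne.symm h')
      omega

theorem exists_eq_X_mul (hP : HasParity n P) (hn : Odd n) :
    ∃ G : R[X], P = Polynomial.X * G ∧ HasParity (n - 1) G := by
  have h0 : P.coeff 0 = 0 := by
    by_contra h
    obtain ⟨j, hj⟩ := hP 0 h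
    obtain ⟨i, hi⟩ := hn
    omega
  obtain ⟨G, rfl⟩ := X_dvd_iff.mpr h0
  refine ⟨G, rfl, fun k hk => ?_⟩
  obtain ⟨j, hj⟩ := hP (k + 1) (by rwa [coeff_X_mul])
  exact ⟨j, by push_cast at hj; omega⟩

end HasParity

/-! ### Representations A² + (1 - X²)B² of positive polynomials -/

/-- `p(X²)` is a norm from `R[X][√(X² - 1)]`, of degree `N` and with the parity of `N`. -/
def IsParityNorm (N : ℕ) (p : R[X]) : Prop :=
  ∃ A B : R[X], HasParity N A ∧ HasParity (N - 1) B ∧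
    p.comp (X ^ 2) = A ^ 2 + (1 - X ^ 2) * B ^ 2

/-- The norm of A + B√(X² - 1) is multiplicative (Brahmagupta's identity). -/
theorem IsParityNorm.mul {N M : ℕ} {p q : R[X]} (hp : IsParityNorm N p)
    (hq : IsParityNorm M q) : IsParityNorm (N + M) (p * q) := by
  obtain ⟨A, B, hA, hB, h⟩ := hp
  obtain ⟨A', B', hA', hB', h'⟩ := hq
  refine ⟨A * A' - (1 - X ^ 2) * (B * B'), A * B' + B * A', ?_, ?_, ?_⟩
  · exact ((hA.mul hA').cast (by push_cast; ring)).sub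
      ((HasParity.one_sub_X_sq.mul (hB.mul hB')).cast (by push_cast; ring))
  · exact ((hA.mul hB').cast (by push_cast; ring)).add ((hB.mul hA').cast (by push_cast; ring))
  · rw [mul_comp, h, h']; ring

theorem isParityNorm_C {a : ℝ} (ha : 0 ≤ a) : IsParityNorm 0 (C a) :=
  ⟨C √a, 0, HasParity.C _, HasParity.zero, by
    rw [C_comp, ← C_pow, Real.sq_sqrt ha]; ring⟩

/-- At v = x² the affine function with values a at 0 and b at 1 is b x² + a(1 - x²). -/
theorem isParityNorm_linear {a b : ℝ} (ha : 0 ≤ a) (hb : 0 ≤ b) :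
    IsParityNorm 1 (C (b - a) * X + C a) :=
  ⟨C √b * X, C √a, HasParity.C_mul _ HasParity.X, (HasParity.C _).cast (by norm_num), by
    simp only [add_comp, mul_comp, C_comp, X_comp, mul_pow, ← C_pow, Real.sq_sqrt ha,
      Real.sq_sqrt hb]
    rw [C_sub]
    ring⟩

/-- With w = ‖z‖ + ‖z - 1‖ one has |x² - z|² = (‖z‖ - w x²)² + (1 - x²)(w² - 1)x², and w ≥ 1 by the
triangle inequality. -/
theorem isParityNorm_quadratic (z : ℂ) :
    IsParityNorm 2 (X ^ 2 - C (2 * z.re) * X + C (‖z‖ ^ 2)) := by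
  have h1 : ‖z - 1‖ ^ 2 = ‖z‖ ^ 2 - 2 * z.re + 1 := by
    rw [Complex.sq_norm, Complex.sq_norm, Complex.normSq_apply, Complex.normSq_apply]
    simp; ring
  have h2 : 1 ≤ ‖z‖ + ‖z - 1‖ := by
    simpa using norm_sub_le z (z - 1)
  have h3 : 0 ≤ (‖z‖ + ‖z - 1‖) ^ 2 - 1 := by nlinarith
  refine ⟨C (-(‖z‖ + ‖z - 1‖)) * X ^ 2 + C ‖z‖, C √((‖z‖ + ‖z - 1‖) ^ 2 - 1) * X, ?_, ?_, ?_⟩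
  · exact (HasParity.C_mul _ ((HasParity.X.pow 2).cast (by norm_num))).add
      (HasParity.C _).add_two
  · exact (HasParity.C_mul _ HasParity.X).cast (by norm_num)
  · rw [mul_pow, ← C_pow (n := 2) (a := √_), Real.sq_sqrt h3]
    simp only [add_comp, sub_comp, mul_comp, C_comp, X_comp, X_pow_comp]
    apply Polynomial.funext
    intro x
    simp only [eval_add, eval_sub, eval_mul, eval_pow, eval_X, eval_C, eval_one]
    linear_combination -x ^ 2 * h1

/-- A polynomial that is positive on `[0, 1]` has, at `x²`, a representation `A² + (1 - x²) B²`. -/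
theorem isParityNorm_of_pos (N : ℕ) :
    ∀ p : ℝ[X], p.natDegree ≤ N → (∀ v ∈ Set.Icc (0 : ℝ) 1, 0 < p.eval v) → IsParityNorm N p := by
  -- Real roots lie outside [0, 1] and the others come in conjugate pairs. Each factor is a norm up
  -- to sign, and the correspondingly signed quotient is again positive on [0, 1].
  induction N using Nat.strong_induction_on with
  | _ N ih =>
  intro p hdeg hpos
  have hconst : p.natDegree = 0 → IsParityNorm N p := by
    intro h0
    rcases N with _ | N
    · rw [eq_C_of_natDegree_eq_zero h0] at hpos ⊢
      exact isParityNorm_C (by simpa using (hpos 0 (by simp)).le)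
    · have h1 := isParityNorm_linear (zero_le_one (α := ℝ)) zero_le_one
      have := (ih N (Nat.lt_succ_self N) p (by omega) hpos).mul h1
      simpa using this
  by_cases h0 : p.natDegree = 0
  · exact hconst h0
  have hp0 : p ≠ 0 := fun h => h0 (by simp [h])
  obtain ⟨z, hz⟩ := IsAlgClosed.exists_aeval_eq_zero ℂ p
    (by rw [degree_eq_natDegree hp0]; exact_mod_cast h0)
  by_cases him : z.im = 0
  · have hroot : p.IsRoot z.re := by
      have : z = (z.re : ℂ) := Complex.ext rfl (by simp [him])
      rw [this] at hz
      have h2 : ((p.eval z.re : ℝ) : ℂ) = 0 := by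
        rw [← hz]; exact (aeval_algebraMap_apply_eq_algebraMap_eval z.re p).symm
      exact_mod_cast h2
    set r := z.re with hr
    obtain ⟨q, rfl⟩ := dvd_iff_isRoot.mpr hroot
    have hq0 : q ≠ 0 := right_ne_zero_of_mul hp0
    have hdq : q.natDegree + 1 ≤ N := by
      rw [natDegree_mul (X_sub_C_ne_zero r) hq0, natDegree_X_sub_C] at hdeg
      omega
    obtain ⟨M, rfl⟩ : ∃ M, N = M + 1 := ⟨N - 1, by omega⟩
    have hev : ∀ v ∈ Set.Icc (0 : ℝ) 1, 0 < (v - r) * q.eval v := by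
      intro v hv; simpa using hpos v hv
    have hr01 : r < 0 ∨ 1 < r := by
      by_contra! h
      simpa using hev r h
    rcases hr01 with h | h
    · have h1 := isParityNorm_linear (a := -r) (b := 1 - r) (by linarith) (by linarith)
      have h2 := (ih M (Nat.lt_succ_self M) q (by omega) fun v hv =>
        pos_of_mul_pos_right (hev v hv) (by linarith [hv.1])).mul h1
      have e : q * (C (1 - r - -r) * X + C (-r)) = (X - C r) * q := by
        simp only [C_neg, C_sub, C_1]; ring
      rwa [e] at h2
    · have h1 := isParityNorm_linear (a := r) (b := r - 1) (by linarith) (by linarith)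
      have h2 := (ih M (Nat.lt_succ_self M) (-q) (by rw [natDegree_neg]; omega) fun v hv => by
        have := hev v hv
        rw [eval_neg]
        nlinarith [hv.2]).mul h1
      have e : -q * (C (r - 1 - r) * X + C r) = (X - C r) * q := by
        simp only [C_sub, C_1]; ring
      rwa [e] at h2
  · obtain ⟨q, rfl⟩ := quadratic_dvd_of_aeval_eq_zero_im_ne_zero p hz him
    have hd2 : (X ^ 2 - C (2 * z.re) * X + C (‖z‖ ^ 2)).natDegree = 2 := by compute_degree!
    have hdq : q.natDegree + 2 ≤ N := by
      rw [natDegree_mul (left_ne_zero_of_mul hp0) (right_ne_zero_of_mul hp0), hd2] at hdeg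
      omega
    obtain ⟨M, rfl⟩ : ∃ M, N = M + 2 := ⟨N - 2, by omega⟩
    have h2 := (ih M (by omega) q (by omega) fun v hv => by
      have h := hpos v hv
      rw [eval_mul] at h
      refine pos_of_mul_pos_right h ?_
      have : eval v (X ^ 2 - C (2 * z.re) * X + C (‖z‖ ^ 2)) = (v - z.re) ^ 2 + z.im ^ 2 := by
        rw [Complex.sq_norm, Complex.normSq_apply]
        simp; ring
      rw [this]; positivity).mul (isParityNorm_quadratic z)
    rwa [mul_comm] at h2

/-- Completion of a real polynomial of definite parity to a signal processing pair. -/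
theorem exists_complement_of_hasParity {n : ℕ} {P : ℝ[X]} (hP : HasParity n P)
    (hlt : ∀ x ∈ Set.Icc (-1 : ℝ) 1, |P.eval x| < 1) :
    ∃ A B : ℝ[X], HasParity n A ∧ HasParity (n - 1) B ∧
      P ^ 2 + A ^ 2 + (1 - X ^ 2) * B ^ 2 = 1 := by
  -- Being even, 1 - P² is some p(X²); the strict bound on P makes p positive on [0, 1].
  have h1 : HasParity (2 * n) (1 - P ^ 2) :=
    (((HasParity.C (1 : ℝ)).add_two_mul n).cast (by ring)).sub ((hP.pow 2).cast (by norm_num))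
  obtain ⟨p, hdeg, hp⟩ := h1.exists_expand_two
  obtain ⟨A, B, hA, hB, h⟩ := isParityNorm_of_pos n p hdeg (by
    intro v hv
    have h2 := congrArg (eval √v) hp
    simp only [eval_comp, eval_pow, eval_X, eval_sub, eval_one, Real.sq_sqrt hv.1] at h2
    rw [h2]
    have h3 := (sq_lt_one_iff_abs_lt_one _).mpr (hlt √v
      ⟨by linarith [Real.sqrt_nonneg v], Real.sqrt_le_one.mpr hv.2⟩)
    linarith)
  exact ⟨A, B, hA, hB, by rw [hp] at h; linear_combination -h⟩

/-! ### Odd polynomials approximating the sign function -/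

theorem HasParity.sum {R ι : Type*} [CommRing R] {n : ℤ} (s : Finset ι) {P : ι → R[X]}
    (h : ∀ i ∈ s, HasParity n (P i)) : HasParity n (∑ i ∈ s, P i) :=
  Finset.sum_induction P (HasParity n) (fun _ _ => HasParity.add) HasParity.zero h

theorem exists_antiderivative_of_hasParity {n : ℤ} {G : ℝ[X]} (hG : HasParity n G) :
    ∃ F : ℝ[X], derivative F = G ∧ F.eval 0 = 0 ∧ HasParity (n + 1) F := by
  refine ⟨∑ k ∈ G.support, C (G.coeff k / (k + 1)) * X ^ (k + 1), ?_, ?_, ?_⟩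
  · conv_rhs => rw [as_sum_support_C_mul_X_pow G]
    rw [derivative_sum]
    refine Finset.sum_congr rfl fun k _ => ?_
    have hk : (k : ℝ) + 1 ≠ 0 := by positivity
    rw [derivative_C_mul_X_pow, Nat.add_sub_cancel]
    congr 2
    push_cast
    field_simp
  · simp [eval_finsetSum]
  · refine HasParity.sum _ fun k hk => ?_
    obtain ⟨j, hj⟩ := hG k (mem_support_iff.mp hk)
    exact (HasParity.C_mul _ ((HasParity.X.pow (k + 1)).add_two_mul j)).cast
      (by push_cast; linarith)

theorem hasParity_chebyshev_T (n : ℕ) : HasParity n (Chebyshev.T ℝ n) := by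
  induction n using Nat.twoStepInduction with
  | zero => simpa using HasParity.C (1 : ℝ)
  | one => simpa using HasParity.X
  | more n h0 h1 =>
    have e : ((n + 1 + 1 : ℕ) : ℤ) = (n : ℤ) + 2 := by push_cast; ring
    rw [e, Chebyshev.T_add_two, mul_assoc]
    refine HasParity.sub ?_ h0.add_two
    exact (HasParity.C_mul 2 (HasParity.X.mul h1)).cast (by push_cast; ring)

theorem abs_chebyshev_T_sin {k : ℕ} (hk : Odd k) (t : ℝ) :
    |(Chebyshev.T ℝ k).eval (Real.sin t)| = |Real.sin (k * t)| := by
  obtain ⟨i, rfl⟩ := hk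
  rw [← Real.cos_pi_div_two_sub, Chebyshev.T_real_cos]
  have e : (((2 * i + 1 : ℕ) : ℤ) : ℝ) * (Real.pi / 2 - t) =
      i * Real.pi + (Real.pi / 2 - ((2 * i + 1 : ℕ) : ℝ) * t) := by
    push_cast; ring
  rw [e, Real.cos_add, Real.sin_nat_mul_pi, Real.cos_nat_mul_pi, Real.cos_pi_div_two_sub]
  simp [abs_mul]

/-- Here |T_k(x)| = |sin(k arcsin x)|, and sin y ≥ 3y/4 on [0, 1]. The bound x ≤ 3/(4k) ≤ sin(1/k)
keeps k arcsin x in that range. -/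
theorem le_abs_chebyshev_T {k : ℕ} (hk : Odd k) {x : ℝ} (hx0 : 0 < x) (hx : x ≤ 3 / (4 * k)) :
    3 / 4 * k * x ≤ |(Chebyshev.T ℝ k).eval x| := by
  have hsin : ∀ y : ℝ, 0 < y → y ≤ 1 → 3 / 4 * y ≤ Real.sin y := by
    intro y h0 h1
    have := Real.sin_gt_sub_cube h0
    nlinarith [mul_nonneg h0.le (sub_nonneg.mpr h1), pow_pos h0 2]
  have hk1 : (1 : ℝ) ≤ k := by exact_mod_cast hk.pos
  have hk0 : (0 : ℝ) < k := by linarith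
  have hx1 : x ≤ 1 := hx.trans (by rw [div_le_one (by positivity)]; linarith)
  have hsx : Real.sin (Real.arcsin x) = x := Real.sin_arcsin (by linarith) hx1
  have ht0 : 0 < Real.arcsin x := Real.arcsin_pos.mpr hx0
  have htx : x ≤ Real.arcsin x := by
    conv_lhs => rw [← hsx]
    exact Real.sin_le ht0.le
  have htk : Real.arcsin x ≤ 1 / k := by
    have h1 : x ≤ Real.sin (1 / k) := by
      refine hx.trans (le_trans (le_of_eq ?_) (hsin (1 / k) (by positivity)
        (by rw [div_le_one hk0]; exact hk1)))
      field_simp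
    have h2 : (1 : ℝ) / k ≤ Real.pi / 2 := by
      have : (1 : ℝ) / k ≤ 1 := by rw [div_le_one hk0]; exact hk1
      linarith [Real.pi_gt_three]
    rw [← Real.arcsin_sin (x := 1 / k) (by
      have : (0 : ℝ) < 1 / k := by positivity
      linarith [Real.pi_pos]) h2]
    exact Real.monotone_arcsin h1
  have hkt : k * Real.arcsin x ≤ 1 := by
    rw [le_div_iff₀ hk0] at htk; linarith
  rw [← hsx, abs_chebyshev_T_sin hk, hsx]
  refine le_trans ?_ ((hsin _ (by positivity) hkt).trans (le_abs_self _))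
  rw [mul_assoc]
  gcongr

/-- An odd polynomial bounded by one on `[-1, 1]` that approximates the sign function
outside `(-d, d)`. -/
theorem exists_sign_approximation {k r : ℕ} (hk : Odd k) (hr : 1 ≤ r) {d : ℝ} (hd0 : 0 < d)
    (hkd2 : 2 ≤ k * d) (hkd5 : k * d ≤ 5) :
    ∃ F : ℝ[X], HasParity (2 * r * (k - 1) + 1) F ∧ (∀ x ∈ Set.Icc (-1 : ℝ) 1, |F.eval x| ≤ 1) ∧
      ∀ x ∈ Set.Icc d 1, 1 - F.eval x ≤ 20 / 3 * (4 / 9) ^ r := by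
  have hk0 : (0 : ℝ) < k := by exact_mod_cast hk.pos
  -- The derivative G^(2r), with G = T_k/X, is even and nonnegative, so F is odd and monotone. It is
  -- at least (3k/4)^(2r) on (0, 3/(4k)) and at most x^(-2r) for d ≤ x ≤ 1, so most of the growth of
  -- F happens near 0.
  obtain ⟨G, hTG, hG⟩ := (hasParity_chebyshev_T k).exists_eq_X_mul (by exact_mod_cast hk)
  obtain ⟨F, hF, hF0, hFp⟩ := exists_antiderivative_of_hasParity (hG.pow (2 * r))
  have hder : ∀ x, deriv (fun y => F.eval y) x = (G.eval x ^ 2) ^ r := by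
    intro x
    rw [Polynomial.deriv, hF, eval_pow, pow_mul]
  have hcont : ∀ s, ContinuousOn (fun y => F.eval y) s := fun s => F.continuous.continuousOn
  have hdiff : ∀ s, DifferentiableOn ℝ (fun y => F.eval y) s := fun s =>
    F.differentiable.differentiableOn
  have hmono : Monotone fun y => F.eval y :=
    monotone_of_deriv_nonneg F.differentiable fun x => by rw [hder]; positivity
  have hTev : ∀ x, (Chebyshev.T ℝ k).eval x = x * G.eval x := fun x => by rw [hTG]; simp
  set a : ℝ := 3 / (4 * k) with ha
  have ha0 : 0 < a := by positivity
  have ha1 : a ≤ 1 := by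
    have : (1 : ℝ) ≤ k := by exact_mod_cast hk.pos
    rw [ha, div_le_one (by positivity)]; linarith
  have hlow : ((3 / 4 * k : ℝ) ^ 2) ^ r * a ≤ F.eval 1 := by
    have h := (convex_Icc 0 a).mul_sub_le_image_sub_of_le_deriv (hcont _) (hdiff _)
      (C := ((3 / 4 * k : ℝ) ^ 2) ^ r) (by
        intro x hx
        rw [interior_Icc] at hx
        rw [hder]
        have h1 := le_abs_chebyshev_T hk hx.1 hx.2.le
        rw [hTev, abs_mul, abs_of_pos hx.1, mul_comm x] at h1
        have h2 := le_of_mul_le_mul_right h1 hx.1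
        rw [← sq_abs (G.eval x)]
        gcongr) 0 (by simp [ha0.le]) a (by simp [ha0.le]) ha0.le
    simp only [sub_zero, hF0] at h
    exact h.trans (hmono ha1)
  have hF1 : 0 < F.eval 1 := lt_of_lt_of_le (by positivity) hlow
  have htail : ∀ x ∈ Set.Icc d 1, F.eval 1 - F.eval x ≤ (1 / d ^ 2) ^ r * d := by
    intro x hx
    -- On [d, 1] one has y^(-2r) ≤ M y^(-2), whose antiderivative is -M/y; monotonicity of the
    -- difference replaces integration.
    set M : ℝ := (1 / d ^ 2) ^ (r - 1) with hM
    have hM0 : 0 < M := by positivity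
    have hne : ∀ y ∈ Set.Icc d 1, y ≠ 0 := fun y hy => (lt_of_lt_of_le hd0 hy.1).ne'
    have hg : ∀ y ∈ Set.Icc d 1,
        HasDerivAt (fun y => -(M * y⁻¹) - F.eval y) (M / y ^ 2 - (G.eval y ^ 2) ^ r) y := by
      intro y hy
      have h1 := ((hasDerivAt_inv (hne y hy)).const_mul M).neg
      have h2 := F.differentiable.differentiableAt.hasDerivAt (x := y)
      rw [hder] at h2
      exact (h1.sub h2).congr_deriv (by rw [div_eq_mul_inv]; ring)
    have hm : MonotoneOn (fun y => -(M * y⁻¹) - F.eval y) (Set.Icc d 1) := by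
      refine monotoneOn_of_deriv_nonneg (convex_Icc d 1)
        (fun y hy => (hg y hy).continuousAt.continuousWithinAt)
        (fun y hy => (hg y (interior_subset hy)).differentiableAt.differentiableWithinAt)
        fun y hy => ?_
      have hy' := interior_subset hy
      have hy0 : 0 < y := lt_of_lt_of_le hd0 hy'.1
      rw [(hg y hy').deriv, sub_nonneg]
      have h1 := Chebyshev.abs_eval_T_real_le_one k (x := y)
        (by rw [abs_of_pos hy0]; exact hy'.2)
      rw [hTev, abs_mul, abs_of_pos hy0] at h1
      have h2 : G.eval y ^ 2 ≤ 1 / y ^ 2 := by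
        rw [le_div_iff₀ (by positivity), ← sq_abs, ← mul_pow, mul_comm]
        exact pow_le_one₀ (by positivity) h1
      have h3 : G.eval y ^ 2 ≤ 1 / d ^ 2 := h2.trans (by gcongr; exact hy'.1)
      obtain ⟨q, rfl⟩ : ∃ q, r = q + 1 := ⟨r - 1, by omega⟩
      rw [pow_succ, hM, Nat.add_sub_cancel, div_eq_mul_one_div (_ ^ q)]
      gcongr
    have h := hm hx ⟨hx.1.trans hx.2, le_rfl⟩ hx.2
    simp only at h
    have h4 : M * x⁻¹ ≤ M * d⁻¹ := by
      gcongr; exact hx.1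
    have h5 : M * d⁻¹ = (1 / d ^ 2) ^ r * d := by
      obtain ⟨q, rfl⟩ : ∃ q, r = q + 1 := ⟨r - 1, by omega⟩
      rw [hM, Nat.add_sub_cancel, pow_succ (1 / d ^ 2), mul_assoc]
      congr 1
      field_simp
    rw [inv_one] at h
    linarith
  refine ⟨C (F.eval 1)⁻¹ * F, HasParity.C_mul _ (hFp.cast (by push_cast; ring)), ?_, ?_⟩
  · have hodd : ∀ x, F.eval (-x) = -F.eval x := by
      have hp : HasParity ((2 * r * (k - 1) + 1 : ℕ) : ℤ) F :=
        hFp.cast (by push_cast [Nat.cast_sub hk.pos]; ring)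
      intro x
      rw [hp.eval_neg, Odd.neg_one_pow ⟨r * (k - 1), by ring⟩]
      ring
    intro x hx
    rw [eval_mul, eval_C, abs_mul, abs_of_pos (inv_pos.mpr hF1), inv_mul_le_iff₀ hF1, mul_one,
      abs_le]
    have h1 := hmono hx.1
    simp only [hodd] at h1
    exact ⟨h1, hmono hx.2⟩
  · intro x hx
    rw [eval_mul, eval_C]
    have e : 1 - (F.eval 1)⁻¹ * F.eval x = (F.eval 1 - F.eval x) / F.eval 1 := by
      field_simp
    rw [e, div_le_iff₀ hF1]
    refine (htail x hx).trans (le_trans ?_ (mul_le_mul_of_nonneg_left hlow (by positivity)))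
    -- The ratio 4/9 comes from kd ≥ 2, and the prefactor 20/3 from d/a = 4kd/3 with kd ≤ 5.
    have h1 : (1 / d ^ 2) ^ r ≤ (4 / 9 * (3 / 4 * k) ^ 2) ^ r := by
      gcongr
      rw [div_le_iff₀ (by positivity)]
      nlinarith
    have h2 : d ≤ 20 / 3 * a := by
      rw [ha, ← mul_div_assoc, le_div_iff₀ (by positivity)]
      linarith
    calc (1 / d ^ 2) ^ r * d ≤ (4 / 9 * (3 / 4 * k) ^ 2) ^ r * (20 / 3 * a) := by gcongr
      _ = _ := by rw [mul_pow]; ring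

end Polynomial

/-! ### The invariant plane and quantum signal processing -/

namespace QErr

variable {m : ℕ}

theorem ketA_apply (a : Fin 2) (w : Qubits m) (b : Fin (m + 1) → Fin 2) :
    ketA a w b = if b 0 = a then w (Fin.tail b) else 0 := rfl

theorem norm_sq_ketA_add (w₀ w₁ : Qubits m) :
    ‖ketA 0 w₀ + ketA 1 w₁‖ ^ 2 = ‖w₀‖ ^ 2 + ‖w₁‖ ^ 2 := by
  rw [EuclideanSpace.norm_sq_eq, EuclideanSpace.norm_sq_eq, EuclideanSpace.norm_sq_eq,
    ← (Fin.consEquiv fun _ : Fin (m + 1) => Fin 2).sum_comp, Fintype.sum_prod_type]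
  simp [ketA_apply, Fin.consEquiv]

theorem smul_ketA (c : ℂ) (a : Fin 2) (w : Qubits m) : c • ketA a w = ketA a (c • w) := by
  ext b
  simp [ketA_apply]

/-- The squared norm of a superposition of `|0⟩|φ₀⟩` and `|1⟩|φ₁⟩`. -/
theorem norm_sq_superposition {φ₀ φ₁ : Qubits m} (h₀ : ‖φ₀‖ = 1) (h₁ : ‖φ₁‖ = 1) (α β : ℂ) :
    ‖α • ketA 0 φ₀ + β • ketA 1 φ₁‖ ^ 2 = ‖α‖ ^ 2 + ‖β‖ ^ 2 := by
  rw [smul_ketA, smul_ketA, norm_sq_ketA_add, norm_smul, norm_smul, h₀, h₁, mul_one, mul_one]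

/-- The diagonal one-qubit gate `diag(u, v)` on the qubit `A`. -/
def diagGate (u v : unitary ℂ) : Step (m + 1) :=
  Step.gate1 0 ⟨Matrix.diagonal ![(u : ℂ), (v : ℂ)], by
    rw [Matrix.mem_unitaryGroup_iff, Matrix.star_eq_conjTranspose, Matrix.diagonal_conjTranspose,
      Matrix.diagonal_mul_diagonal, ← Matrix.diagonal_one]
    congr 1
    funext i
    fin_cases i
    · exact Unitary.mul_star_self_of_mem u.2
    · exact Unitary.mul_star_self_of_mem v.2⟩

theorem diagGate_act (O : Qubits (m + 1) ≃ₗᵢ[ℂ] Qubits (m + 1)) (u v : unitary ℂ)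
    (φ₀ φ₁ : Qubits m) (α β : ℂ) :
    (diagGate u v).act O (α • ketA 0 φ₀ + β • ketA 1 φ₁) =
      (u * α) • ketA 0 φ₀ + (v * β) • ketA 1 φ₁ := by
  ext b
  have hb : Fin.tail (Function.update b 0 (b 0)) = Fin.tail b := by simp
  generalize hx : b 0 = x at hb
  fin_cases x <;> simp [diagGate, Step.act, Matrix.diagonal_apply, ketA_apply, hx, mul_assoc]

theorem run_append (O : Qubits m ≃ₗᵢ[ℂ] Qubits m) (A B : QueryAlgorithm m) (ψ : Qubits m) :
    QueryAlgorithm.run O (A ++ B : List (Step m)) ψ = B.run O (A.run O ψ) :=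
  List.foldl_append

/-- On the plane of `|0⟩|φ₀⟩` and `|1⟩|φ₁⟩`, the oracle acts as the reflection
`!![c, s; s, -c]` with `c = 1 - 2p` and `s = 2√(p(1-p))`. -/
theorem IsReflectingOracle.apply_superposition {p : ℝ} (hp0 : 0 ≤ p) (hp1 : p ≤ 1)
    {φ₀ φ₁ : Qubits m} {O : Qubits (m + 1) ≃ₗᵢ[ℂ] Qubits (m + 1)}
    (hO : IsReflectingOracle p φ₀ φ₁ O) (α β : ℂ) :
    O (α • ketA 0 φ₀ + β • ketA 1 φ₁) =
      (((1 - 2 * p : ℝ) : ℂ) * α + ((2 * (√p * √(1 - p)) : ℝ) : ℂ) * β) • ketA 0 φ₀ +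
      (((2 * (√p * √(1 - p)) : ℝ) : ℂ) * α - ((1 - 2 * p : ℝ) : ℂ) * β) • ketA 1 φ₁ := by
  obtain ⟨hv, hw⟩ := hO
  have hp : ((√p : ℝ) : ℂ) ^ 2 = p := by exact_mod_cast Real.sq_sqrt hp0
  have hq : ((√(1 - p) : ℝ) : ℂ) ^ 2 = 1 - p := by
    exact_mod_cast Real.sq_sqrt (sub_nonneg.mpr hp1)
  set a : ℂ := ((√p : ℝ) : ℂ) with ha
  set b : ℂ := ((√(1 - p) : ℝ) : ℂ) with hb
  set e₀ := ketA 0 φ₀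
  set e₁ := ketA 1 φ₁
  have h : α • e₀ + β • e₁ = (b * α + a * β) • (b • e₀ + a • e₁) +
      (a * α - b * β) • (a • e₀ - b • e₁) := by
    match_scalars
    · linear_combination -α * hp - α * hq
    · linear_combination -β * hp - β * hq
  rw [h, map_add, map_smul, map_smul, hv, hw]
  push_cast
  rw [← ha, ← hb]
  match_scalars
  · linear_combination α * hq - α * hp
  · linear_combination β * hp - β * hq

open QueryAlgorithm in
/-- Quantum signal processing: a pair of polynomials with the right parities and the
normalization `P P̄ + (1 - X²) Q Q̄ = 1` is realized by a circuit with `n` queries. -/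
theorem exists_circuit (m : ℕ) (n : ℕ) : ∀ P Q : ℂ[X], HasParity n P → HasParity (n - 1) Q →
    P * P.map (starRingEnd ℂ) + (1 - X ^ 2) * (Q * Q.map (starRingEnd ℂ)) = 1 →
    ∃ A : QueryAlgorithm (m + 1), A.queries = n ∧ A.gates = 2 * n + 1 ∧
      ∀ (c s : ℂ) (φ₀ φ₁ : Qubits m) (O : Qubits (m + 1) ≃ₗᵢ[ℂ] Qubits (m + 1)),
      c ^ 2 + s ^ 2 = 1 →
      (∀ α β : ℂ, O (α • ketA 0 φ₀ + β • ketA 1 φ₁) =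
        (c * α + s * β) • ketA 0 φ₀ + (s * α - c * β) • ketA 1 φ₁) →
      ∀ α β : ℂ, A.run O (α • ketA 0 φ₀ + β • ketA 1 φ₁) =
        (P.eval c * α - s * (Q.map (starRingEnd ℂ)).eval c * β) • ketA 0 φ₀ +
        (s * Q.eval c * α + (P.map (starRingEnd ℂ)).eval c * β) • ketA 1 φ₁ := by
  induction n with
  | zero =>
    intro P Q hP hQ h
    -- Parity index -1 admits no monomial at all.
    have hQ0 : Q = 0 := by
      ext k
      by_contra hk
      obtain ⟨j, hj⟩ := hQ k hk
      push_cast at hj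
      omega
    have hP0 : P = C (P.coeff 0) := eq_C_of_natDegree_eq_zero (by simpa using hP.natDegree_le)
    set u := P.coeff 0
    subst hQ0
    rw [hP0] at h ⊢
    have hu : u * star u = 1 := by
      have := congrArg (eval 0) h
      simpa using this
    have hmem : u ∈ unitary ℂ := Unitary.mem_iff.mpr ⟨by rw [mul_comm]; exact hu, hu⟩
    refine ⟨[diagGate ⟨u, hmem⟩ (star ⟨u, hmem⟩)], rfl, rfl, ?_⟩
    intro c s φ₀ φ₁ O _ _ α β
    simp only [run, List.foldl_cons, List.foldl_nil, diagGate_act]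
    simp
  | succ n ih =>
    intro P Q hP hQ h
    set p := P.coeff (n + 1) with hp
    set q := Q.coeff n with hq
    -- This is the vanishing coefficient of degree 2n + 2 in the normalization; it gives |p| = |q|.
    have hpq : p * star p = q * star q := by
      have h1 := congrArg (fun R => coeff R ((n + 1) + (n + 1))) h
      have hPd : P.natDegree ≤ n + 1 := by simpa using hP.natDegree_le
      have hQd : Q.natDegree ≤ n := by simpa using hQ.natDegree_le
      have e2 : ((1 - X ^ 2 : ℂ[X]) * (Q * Q.map (starRingEnd ℂ))).coeff ((n + 1) + (n + 1)) =
          -(q * star q) := by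
        rw [show (n + 1) + (n + 1) = 2 + (n + n) by ring]
        rw [coeff_mul_add_eq_of_natDegree_le (by compute_degree!)
          (natDegree_mul_le_of_le hQd (natDegree_map_le.trans hQd)),
          coeff_mul_add_eq_of_natDegree_le hQd (natDegree_map_le.trans hQd), coeff_map]
        simp [coeff_one, hq]
      simp only [coeff_add, e2] at h1
      rw [coeff_mul_add_eq_of_natDegree_le hPd (natDegree_map_le.trans hPd), coeff_map,
        coeff_one, if_neg (by omega)] at h1
      exact eq_of_sub_eq_zero (by rw [sub_eq_add_neg]; exact h1)
    -- A square root of p/q, which is unimodular since |p| = |q|.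
    obtain ⟨u, hu, hupq⟩ : ∃ u : ℂ, u * star u = 1 ∧ star u * p = u * q := by
      by_cases hq0 : q = 0
      · have hp0 : p = 0 := by
          rw [hq0, zero_mul] at hpq
          simpa using hpq
        exact ⟨1, by simp, by simp [hq0, hp0]⟩
      · obtain ⟨u, hu⟩ := IsAlgClosed.exists_pow_nat_eq (p / q) two_pos
        have hn : ‖p‖ = ‖q‖ := by
          have h2 := congrArg norm hpq
          simp only [norm_mul, norm_star] at h2
          exact (mul_self_inj (norm_nonneg _) (norm_nonneg _)).mp h2
        have hu1 : ‖u‖ = 1 := by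
          have h3 := congrArg norm hu
          rw [norm_pow, norm_div, hn, div_self (norm_ne_zero_iff.mpr hq0)] at h3
          exact (pow_eq_one_iff_of_nonneg (norm_nonneg _) two_ne_zero).mp h3
        have hus : u * star u = 1 := by
          rw [← starRingEnd_apply, Complex.mul_conj, Complex.normSq_eq_norm_sq, hu1]
          simp
        refine ⟨u, hus, ?_⟩
        rw [eq_div_iff hq0] at hu
        linear_combination -star u * hu + u * q * hus
    have hmem : u ∈ unitary ℂ := Unitary.mem_iff.mpr ⟨by rw [mul_comm]; exact hu, hu⟩
    have hCu : C u * C (star u) = 1 := by rw [← C_mul, hu, C_1]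
    -- The oracle times diag(1, -1) is the rotation with entries c, s. P' and Q' describe the target
    -- after removal of the phase diag(u, ū) and this rotation, using s² = 1 - c². The choice of u
    -- cancels their top coefficients, and parity then lowers the degree bounds by two.
    set P' : ℂ[X] := C (star u) * (X * P) + C u * ((1 - X ^ 2) * Q) with hP'
    set Q' : ℂ[X] := C u * (X * Q) - C (star u) * P with hQ'
    have hP'm : P'.map (starRingEnd ℂ) = C u * (X * P.map (starRingEnd ℂ)) +
        C (star u) * ((1 - X ^ 2) * Q.map (starRingEnd ℂ)) := by
      simp [hP', Polynomial.map_add, Polynomial.map_mul, Polynomial.map_sub, Polynomial.map_pow]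
    have hQ'm : Q'.map (starRingEnd ℂ) = C (star u) * (X * Q.map (starRingEnd ℂ)) -
        C u * P.map (starRingEnd ℂ) := by
      simp [hQ', Polynomial.map_mul, Polynomial.map_sub]
    have hQd : Q.coeff (n + 2) = 0 := by
      by_contra hk
      obtain ⟨j, hj⟩ := hQ _ hk
      push_cast at hj
      omega
    have hpar : HasParity n P' := by
      have h1 : HasParity (n + 2) P' :=
        (HasParity.C_mul _ ((HasParity.X.mul hP).cast (by push_cast; ring))).add
          (HasParity.C_mul _ ((HasParity.one_sub_X_sq.mul hQ).cast (by push_cast; ring)))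
      refine (h1.sub_two ?_).cast (by ring)
      rw [show ((n : ℤ) + 2).toNat = n + 1 + 1 by omega]
      rw [hP', coeff_add, coeff_C_mul, coeff_C_mul, coeff_X_mul, sub_mul, one_mul, coeff_sub,
        coeff_X_pow_mul, hQd]
      linear_combination hupq
    have hparQ : HasParity (n - 1) Q' := by
      have h1 : HasParity (n + 1) Q' :=
        (HasParity.C_mul _ ((HasParity.X.mul hQ).cast (by push_cast; ring))).sub
          (HasParity.C_mul _ (hP.cast (by push_cast; ring)))
      refine (h1.sub_two ?_).cast (by ring)
      rw [show ((n : ℤ) + 1).toNat = n + 1 by omega]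
      rw [hQ', coeff_sub, coeff_C_mul, coeff_C_mul, coeff_X_mul]
      linear_combination -hupq
    obtain ⟨A, hAq, hAg, hA⟩ := ih P' Q' hpar hparQ (by
      rw [hP'm, hQ'm, hP', hQ']
      linear_combination h + (P * P.map (starRingEnd ℂ) +
        (1 - X ^ 2) * (Q * Q.map (starRingEnd ℂ))) * hCu)
    have hneg : (-1 : ℂ) ∈ unitary ℂ := by simp [Unitary.mem_iff]
    refine ⟨A ++ [diagGate 1 ⟨-1, hneg⟩, Step.query, diagGate ⟨u, hmem⟩ (star ⟨u, hmem⟩)],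
      ?_, ?_, ?_⟩
    · rw [queries, List.countP_append]
      exact congrArg (· + 1) hAq
    · rw [gates, List.countP_append]
      have h2 : A.gates + 2 = 2 * (n + 1) + 1 := by omega
      exact h2
    · intro c s φ₀ φ₁ O hcs hO α β
      rw [run_append, hA c s φ₀ φ₁ O hcs hO]
      have hquery : ∀ ψ, Step.query.act O ψ = O ψ := fun _ => rfl
      simp only [run, List.foldl_cons, List.foldl_nil, diagGate_act, hquery, hO]
      rw [hP'm, hQ'm, hP', hQ']
      simp only [eval_add, eval_sub, eval_mul, eval_C, eval_X, eval_pow, eval_one,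
        OneMemClass.coe_one, Unitary.coe_star]
      set a := P.eval c
      set b := Q.eval c
      set a' := (P.map (starRingEnd ℂ)).eval c
      set b' := (Q.map (starRingEnd ℂ)).eval c
      congr 2
      · linear_combination ((u * star u * a - u ^ 2 * b * c) * α) * hcs + (a * α - s * b' * β) * hu
      · linear_combination ((u * star u * a' - star u ^ 2 * b' * c) * β) * hcs +
          (s * b * α + a' * β) * hu

/-- The distance that a special unitary `!![P, -s conj Q; s Q, conj P]` moves a state of the plane
of `|0⟩|φ₀⟩` and `|1⟩|φ₁⟩`, up to the sign `σ`. -/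
theorem norm_sq_rotation_sub {m : ℕ} {φ₀ φ₁ : Qubits m} (h₀ : ‖φ₀‖ = 1) (h₁ : ‖φ₁‖ = 1)
    {a b : ℂ} {σ s : ℝ} (hσ : σ ^ 2 = 1) (hab : Complex.normSq a + s ^ 2 * Complex.normSq b = 1)
    {α β : ℂ} (hφ : ‖α • ketA 0 φ₀ + β • ketA 1 φ₁‖ = 1) :
    ‖((a * α - s * star b * β) • ketA 0 φ₀ + (s * b * α + star a * β) • ketA 1 φ₁) -
      (σ : ℂ) • (α • ketA 0 φ₀ + β • ketA 1 φ₁)‖ ^ 2 = 2 * (1 - σ * a.re) := by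
  have e : ((a * α - s * star b * β) • ketA 0 φ₀ + (s * b * α + star a * β) • ketA 1 φ₁) -
      (σ : ℂ) • (α • ketA 0 φ₀ + β • ketA 1 φ₁) =
      ((a - σ) * α - s * star b * β) • ketA 0 φ₀ + (s * b * α + (star a - σ) * β) • ketA 1 φ₁ := by
    module
  have hφ2 := norm_sq_superposition h₀ h₁ α β
  rw [hφ] at hφ2
  rw [e, norm_sq_superposition h₀ h₁]
  simp only [Complex.sq_norm, Complex.normSq_apply] at hφ2 hab ⊢
  simp only [Complex.add_re, Complex.sub_re, Complex.mul_re, Complex.add_im, Complex.sub_im,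
    Complex.mul_im, Complex.ofReal_re, Complex.ofReal_im, Complex.star_def, Complex.conj_re,
    Complex.conj_im]
  -- The Hermitian part of this SU(2) matrix is Re a times the identity, so the distance is the same
  -- for all unit vectors of the plane.
  linear_combination (α.re * α.re + α.im * α.im + (β.re * β.re + β.im * β.im)) * (hab + hσ) -
    2 * (1 - σ * a.re) * hφ2

/-- Quantum signal processing for a real polynomial `R`: the circuit multiplies every state of the
plane by `R(1 - 2p)`, up to the error forced by unitarity. -/
theorem exists_circuit_of_real (m n : ℕ) {R : ℝ[X]} (hR : HasParity n R)
    (hlt : ∀ x ∈ Set.Icc (-1 : ℝ) 1, |R.eval x| < 1) :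
    ∃ A : QueryAlgorithm (m + 1), A.queries = n ∧ A.gates = 2 * n + 1 ∧
      ∀ p : ℝ, 0 ≤ p → p ≤ 1 → ∀ φ₀ φ₁ : Qubits m, ‖φ₀‖ = 1 → ‖φ₁‖ = 1 →
      ∀ O : Qubits (m + 1) ≃ₗᵢ[ℂ] Qubits (m + 1), IsReflectingOracle p φ₀ φ₁ O →
      ∀ φ ∈ Submodule.span ℂ {ketA 0 φ₀, ketA 1 φ₁}, ‖φ‖ = 1 → ∀ σ : ℝ, σ ^ 2 = 1 →
        ‖A.run O φ - (σ : ℂ) • φ‖ ^ 2 = 2 * (1 - σ * R.eval (1 - 2 * p)) := by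
  obtain ⟨S, B, hS, hB, hsum⟩ := exists_complement_of_hasParity hR hlt
  set ι : ℝ →+* ℂ := Complex.ofRealHom with hι
  have hconj : (starRingEnd ℂ).comp ι = ι := RingHom.ext fun x => Complex.conj_ofReal x
  have hmapR : ∀ P : ℝ[X], (P.map ι).map (starRingEnd ℂ) = P.map ι := fun P => by
    rw [map_map, hconj]
  have hev : ∀ (P : ℝ[X]) (x : ℝ), (P.map ι).eval (x : ℂ) = ((P.eval x : ℝ) : ℂ) :=
    fun P x => eval_map_apply ι x
  have hI : C Complex.I * C Complex.I = (-1 : ℂ[X]) := by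
    rw [← C_mul, Complex.I_mul_I, C_neg, C_1]
  have hmap : R.map ι ^ 2 + S.map ι ^ 2 + (1 - X ^ 2) * B.map ι ^ 2 = 1 := by
    simpa [Polynomial.map_add, Polynomial.map_mul, Polynomial.map_sub, Polynomial.map_pow] using
      congrArg (Polynomial.map ι) hsum
  have hPm : (R.map ι + C Complex.I * S.map ι).map (starRingEnd ℂ) =
      R.map ι - C Complex.I * S.map ι := by
    rw [Polynomial.map_add, Polynomial.map_mul, hmapR, hmapR, map_C, Complex.conj_I, C_neg]
    ring
  -- The complement S enters as an imaginary part, so that Re P(c) = R(c).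
  obtain ⟨A, hq, hg, hA⟩ := exists_circuit m n (R.map ι + C Complex.I * S.map ι) (B.map ι)
    ((hR.map ι).add ((hS.map ι).C_mul _)) (hB.map ι) (by
      rw [hPm, hmapR]
      linear_combination hmap - S.map ι ^ 2 * hI)
  refine ⟨A, hq, hg, ?_⟩
  intro p hp0 hp1 φ₀ φ₁ h₀ h₁ O hO φ hφ hnorm σ hσ
  obtain ⟨α, β, rfl⟩ := Submodule.mem_span_pair.mp hφ
  set c : ℝ := 1 - 2 * p with hc
  set s : ℝ := 2 * (√p * √(1 - p)) with hs
  have hcs : c ^ 2 + s ^ 2 = 1 := by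
    rw [hs, mul_pow, mul_pow, Real.sq_sqrt hp0, Real.sq_sqrt (sub_nonneg.mpr hp1), hc]
    ring
  rw [hA c s φ₀ φ₁ O (by exact_mod_cast hcs) (hO.apply_superposition hp0 hp1) α β, hPm, hmapR]
  have e1 : (R.map ι - C Complex.I * S.map ι).eval (c : ℂ) =
      star ((R.map ι + C Complex.I * S.map ι).eval (c : ℂ)) := by
    simp only [eval_sub, eval_add, eval_mul, eval_C, hev, Complex.star_def, map_add, map_mul,
      Complex.conj_I, Complex.conj_ofReal]
    ring
  have e2 : (B.map ι).eval (c : ℂ) = star ((B.map ι).eval (c : ℂ)) := by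
    rw [hev, Complex.star_def, Complex.conj_ofReal]
  have hval : (R.map ι + C Complex.I * S.map ι).eval (c : ℂ) = ⟨R.eval c, S.eval c⟩ := by
    simp only [eval_add, eval_mul, eval_C, hev]
    apply Complex.ext <;> simp
  have key := norm_sq_rotation_sub h₀ h₁ (a := ⟨R.eval c, S.eval c⟩)
    (b := (B.map ι).eval (c : ℂ)) (s := s) hσ (by
      have h1 := congrArg (eval c) hsum
      simp only [eval_add, eval_mul, eval_sub, eval_pow, eval_X, eval_one] at h1
      rw [hev, Complex.normSq_ofReal, Complex.normSq_mk]
      linear_combination h1 + B.eval c ^ 2 * hcs) hnorm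
  rw [← e2, ← hval, ← e1] at key
  rw [key, hval]

/-! ### Choice of parameters and conclusion -/

/-- A strictly bounded odd polynomial approximating the sign function. -/
theorem exists_strict_sign_approximation {ε δ : ℝ} (hε : 0 < ε) (hδ : 0 < δ) (hδ2 : δ ≤ 1 / 2) :
    ∃ (n : ℕ) (R : ℝ[X]), Odd n ∧ (n : ℝ) ≤ 65 * (1 / δ * max 1 (Real.log (1 / ε))) ∧
      HasParity n R ∧ (∀ x ∈ Set.Icc (-1 : ℝ) 1, |R.eval x| < 1) ∧
      ∀ x ∈ Set.Icc (2 * δ) 1, 2 * (1 - R.eval x) ≤ ε ^ 2 := by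
  set L := max 1 (Real.log (1 / ε)) with hL
  have hL1 : 1 ≤ L := le_max_left _ _
  -- The error is split as 1 - R ≤ 2η, half from the approximation and half from the rescaling by 1
  -- - η that makes the bound strict; 4η ≤ ε² because exp(-L) ≤ ε.
  set η : ℝ := Real.exp (-(2 * L)) / 4 with hη
  have hη0 : 0 < η := by positivity
  have hηε : 4 * η ≤ ε ^ 2 := by
    have h1 : Real.log (1 / ε) ≤ L := le_max_right _ _
    rw [one_div, Real.log_inv] at h1
    have h2 : Real.exp (-L) ≤ ε := by
      rw [← Real.le_log_iff_exp_le hε]; linarith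
    have h3 : 4 * η = Real.exp (-L) ^ 2 := by
      rw [← Real.exp_nat_mul, hη]; push_cast; ring_nf
    rw [h3]
    gcongr
  have hη1 : η < 1 := by
    have : Real.exp (-(2 * L)) ≤ 1 := Real.exp_le_one_iff.mpr (by linarith)
    linarith
  -- Since 4/9 ≤ exp(-1/2), this gives (4/9)^r ≤ exp(-6L); the spare factor exp(-4L) ≤ 3/80 absorbs
  -- the constant 20/3 and the 1/4 in η.
  set r : ℕ := ⌈12 * L⌉₊ with hr
  have hr1 : 12 * L ≤ r := Nat.le_ceil _
  have hr2 : (r : ℝ) < 12 * L + 1 := Nat.ceil_lt_add_one (by linarith)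
  have hr0 : 1 ≤ r := by
    have : (1 : ℝ) ≤ r := by linarith
    exact_mod_cast this
  have hpow : 20 / 3 * (4 / 9 : ℝ) ^ r ≤ η := by
    have he : (4 / 9 : ℝ) ≤ Real.exp (-(1 / 2)) := by
      have := Real.add_one_le_exp (-(1 / 2) : ℝ)
      linarith
    have h1 : (4 / 9 : ℝ) ^ r ≤ Real.exp (-(6 * L)) := by
      calc (4 / 9 : ℝ) ^ r ≤ Real.exp (-(1 / 2)) ^ r := by gcongr
        _ = Real.exp (r * (-(1 / 2))) := by rw [Real.exp_nat_mul]
        _ ≤ Real.exp (-(6 * L)) := by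
          rw [Real.exp_le_exp]; linarith
    have h2 : Real.exp (-(6 * L)) = Real.exp (-(4 * L)) * Real.exp (-(2 * L)) := by
      rw [← Real.exp_add]; ring_nf
    have h3 : Real.exp (-(4 * L)) ≤ 3 / 80 := by
      have h4 : (80 / 3 : ℝ) ≤ Real.exp (4 * L) := by
        have h5 : Real.exp (4 * L) = Real.exp L ^ 4 := by
          rw [← Real.exp_nat_mul]; norm_num
        have h6 : (2.7 : ℝ) ≤ Real.exp L := by
          have := Real.exp_one_gt_d9
          have h7 : Real.exp 1 ≤ Real.exp L := Real.exp_le_exp.mpr hL1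
          linarith
        rw [h5]
        calc (80 / 3 : ℝ) ≤ 2.7 ^ 4 := by norm_num
          _ ≤ _ := by gcongr
      rw [Real.exp_neg, inv_le_comm₀ (Real.exp_pos _) (by norm_num)]
      linarith
    rw [hη]
    rw [h2] at h1
    nlinarith [Real.exp_pos (-(2 * L))]
  -- Odd, with 2 ≤ k · 2δ ≤ 2 + 6δ ≤ 5; the last inequality uses δ ≤ 1/2.
  set k : ℕ := 2 * ⌈1 / (2 * δ)⌉₊ + 1 with hk
  have hk1 : 2 ≤ k * (2 * δ) := by
    have h1 := Nat.le_ceil (1 / (2 * δ))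
    rw [div_le_iff₀ (by positivity)] at h1
    rw [hk]; push_cast; nlinarith
  have hk2 : k * (2 * δ) ≤ 5 := by
    have h1 := Nat.ceil_lt_add_one (a := 1 / (2 * δ)) (by positivity)
    have h2 : 1 / (2 * δ) * (2 * δ) = 1 := by field_simp
    rw [hk]; push_cast; nlinarith
  have hkodd : Odd k := ⟨_, rfl⟩
  obtain ⟨F, hF, hF1, hFs⟩ := exists_sign_approximation hkodd hr0 (by positivity) hk1 hk2
  refine ⟨2 * r * (k - 1) + 1, C (1 - η) * F, ⟨r * (k - 1), by ring⟩, ?_, ?_, ?_, ?_⟩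
  · push_cast [Nat.cast_sub hkodd.pos]
    have h1 : (k : ℝ) ≤ 5 / (2 * δ) := by
      rw [le_div_iff₀ (by positivity)]; exact hk2
    have hr' : (1 : ℝ) ≤ r := by exact_mod_cast hr0
    calc (2 * r * (k - 1) + 1 : ℝ) ≤ 2 * r * k := by linarith
      _ ≤ 2 * (13 * L) * (5 / (2 * δ)) := by gcongr; linarith
      _ = 65 * (1 / δ * L) := by field_simp; ring
  · exact (hF.C_mul _).cast (by push_cast [Nat.cast_sub hkodd.pos]; ring)
  · intro x hx
    rw [eval_mul, eval_C, abs_mul, abs_of_pos (by linarith)]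
    nlinarith [hF1 x hx, abs_nonneg (F.eval x)]
  · intro x hx
    rw [eval_mul, eval_C]
    have h1 := hFs x hx
    have h2 := (abs_le.mp (hF1 x ⟨by linarith [hx.1], hx.2⟩)).2
    nlinarith

end QErr

theorem theorem1p4 :
    ∃ C : ℝ, 0 < C ∧ ∀ (ε δ : ℝ), 0 < ε → 0 < δ → ∀ m : ℕ,
      ∃ A : QErr.QueryAlgorithm (m + 1),
        (A.queries : ℝ) ≤ C * (1 / δ * max 1 (Real.log (1 / ε))) ∧
        (A.gates : ℝ) ≤ C * (A.queries : ℝ) ∧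
        ∀ (p : ℝ), 0 ≤ p → p ≤ 1 →
        ∀ (φ₀ φ₁ : QErr.Qubits m), ‖φ₀‖ = 1 → ‖φ₁‖ = 1 →
        ∀ (O : QErr.Qubits (m + 1) ≃ₗᵢ[ℂ] QErr.Qubits (m + 1)),
          QErr.IsReflectingOracle p φ₀ φ₁ O →
        ∀ φ ∈ Submodule.span ℂ {QErr.ketA 0 φ₀, QErr.ketA 1 φ₁}, ‖φ‖ = 1 →
          (p ≤ 1 / 2 - δ → ‖A.run O φ - φ‖ ≤ ε) ∧
          (1 / 2 + δ ≤ p → ‖A.run O φ - (-φ)‖ ≤ ε) := by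
  refine ⟨65, by norm_num, fun ε δ hε hδ m => ?_⟩
  -- For δ > 1/2 no p in [0, 1] meets either condition, and the empty circuit suffices.
  by_cases hδ2 : δ ≤ 1 / 2
  · obtain ⟨n, R, hn, hnle, hR, hlt, happ⟩ :=
      QErr.exists_strict_sign_approximation hε hδ hδ2
    obtain ⟨A, hq, hg, hA⟩ := QErr.exists_circuit_of_real m n hR hlt
    refine ⟨A, by rwa [hq], ?_, ?_⟩
    · have : (1 : ℝ) ≤ n := by exact_mod_cast hn.pos
      rw [hg, hq]; push_cast; linarith
    · intro p hp0 hp1 φ₀ φ₁ h₀ h₁ O hO φ hφ hnorm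
      have h := hA p hp0 hp1 φ₀ φ₁ h₀ h₁ O hO φ hφ hnorm
      constructor
      · intro hp
        have h1 := h 1 (by norm_num)
        rw [Complex.ofReal_one, one_smul, one_mul] at h1
        refine (sq_le_sq₀ (norm_nonneg _) hε.le).mp ?_
        rw [h1]
        exact happ _ ⟨by linarith, by linarith⟩
      · intro hp
        have h1 := h (-1) (by norm_num)
        rw [Complex.ofReal_neg, Complex.ofReal_one, neg_one_smul] at h1
        refine (sq_le_sq₀ (norm_nonneg _) hε.le).mp ?_
        -- Oddness of R transfers the estimate to negative arguments.
        have h2 := happ (-(1 - 2 * p)) ⟨by linarith, by linarith⟩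
        rw [hR.eval_neg, hn.neg_one_pow] at h2
        rw [h1]
        exact h2
  · refine ⟨[], ?_, ?_, ?_⟩
    · simp only [QErr.QueryAlgorithm.queries, List.countP_nil, Nat.cast_zero]
      positivity
    · simp [QErr.QueryAlgorithm.gates, QErr.QueryAlgorithm.queries]
    · intro p hp0 hp1 φ₀ φ₁ _ _ O _ φ _ _
      exact ⟨fun h => by linarith, fun h => by linarith⟩

end
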